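/- **Proposition (block-reduced hypercube SDP).** Let $n\ge 1$ and $d\ge 0$ be integers. Write $\mathbb R[x]_{\le k}$ for the space of real polynomials in $x_1,\dots,x_n$ of degree at most $k$ (with $\deg 0=-\infty$, so $\mathbb R[x]_{\le -1}=0$). Let $S_n$ act on polynomials by $\pi\cdot x_i=x_{\pi(i)}$, and let $S_{n-1}\subseteq S_n$ be the stabilizer of $n$. Let $M_{n,2d}(\mathbf g)$, $g_i=x_i-x_i^2$, be the truncated quadratic module, i.e. the set of all polynomials $\sigma_0+\sum_{i=1}^n\sigma_i\,(x_i-x_i^2)$ where $\sigma_0,\dots,\sigma_n$ are sums of squares of real polynomials with $\deg\sigma_0\le 2d$ and $\deg\sigma_i\le 2d-2$ for $i\ge1$. For a finite group $G$ of permutations of the variables put $\mathcal S_G(f)=\sum_{g\in G}g\cdot f$. A *representative set* for a real representation $V$ of a finite group $G$ is a finite family of tuples $U_\lambda=(u_{\lambda,1},\dots,u_{\lambda,m_\lambda})$ with $m_\lambda\ge 0$, for which there is a decomposition $V=\bigoplus_\lambda\bigoplus_{j=1}^{m_\lambda}V_{\lambda,j}$ into irreducible subrepresentations such that $V_{\lambda,j}\not\cong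 V_{\lambda',j'}$ whenever $\lambda\ne\lambda'$, each $u_{\lambda,j}$ is a nonzero vector of $V_{\lambda,j}$, and for all $\lambda,j,j'$ there is a $G$-isomorphism $V_{\lambda,j}\to V_{\lambda,j'}$ mapping $u_{\lambda,j}$ to $u_{\lambda,j'}$. (For $S_n$ one can take the index $\lambda$ to run over the partitions of $n$, with $m_\lambda=0$ for the types that do not occur in $V$.) Let $(U_\lambda)_\lambda$, $U_\lambda=(u_{\lambda,1},\dots,u_{\lambda,m_\lambda})$, be any representative set for $S_n$ acting on $\mathbb R[x]_{\le d}$, and let $(V_\mu)_\mu$, $V_\mu=(v_{\mu,1},\dots,v_{\mu,r_\mu})$, be any representative set for $S_{n-1}$ acting on $\mathbb R[x]_{\le d-1}$. Define $$X_\lambda=\bigl(\mathcal S_{S_n}(u_{\lambda,a}u_{\lambda,b})\bigr)_{a,b=1}^{m_\lambda},\qquad Y_\mu=\bigl(\mathcal S_{S_{n-1}}(v_{\mu,a}v_{\mu,b})\bigr)_{a,b=1}^{r_\mu}.$$ Then an $S_n$-invariant polynomial $p\in\mathbb R[x_1,\dots,x_n]$ lies in $M_{n,2d}(\mathbf g)$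 if and only if there exist real symmetric positive semidefinite matrices $Q_\lambda\in\mathbb R^{m_\lambda\times m_\lambda}$ and $R_\mu\in\mathbb R^{r_\mu\times r_\mu}$ such that $$p=\sum_\lambda\langle Q_\lambda,X_\lambda\rangle+\sum_{i=1}^n\Bigl((i\,n)\cdot\sum_\mu\langle R_\mu,Y_\mu\rangle\Bigr)(x_i-x_i^2),$$ where $\langle Q,X\rangle=\sum_{a,b}Q_{ab}X_{ab}$ and $(i\,n)$ is the transposition of $i$ and $n$ (the identity for $i=n$). -/

import Mathlib

namespace HypercubeSDP

noncomputable section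

open MvPolynomial

/-- `ℝ[x₁,…,xₙ]_{≤ k}`, the real polynomials all of whose monomials have total degree at most `k`.
The bound is an integer: for `k < 0` this is the zero space (the zero polynomial has
degree `-∞`). -/
def polyLE (n : ℕ) (k : ℤ) : Submodule ℝ (MvPolynomial (Fin n) ℝ) :=
  restrictSupport ℝ {m : Fin n →₀ ℕ | (m.degree : ℤ) ≤ k}

theorem rename_mem_polyLE {n : ℕ} {k : ℤ} (e : Fin n → Fin n) {p : MvPolynomial (Fin n) ℝ}
    (hp : p ∈ polyLE n k) : rename e p ∈ polyLE n k := by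
  classical
  intro m hm
  obtain ⟨m', rfl, hm'⟩ := coeff_rename_ne_zero e p m (mem_support_iff.mp hm)
  have h : ((m'.degree : ℕ) : ℤ) ≤ k := hp (mem_support_iff.mpr hm')
  change (((m'.mapDomain e).degree : ℕ) : ℤ) ≤ k
  rwa [Finsupp.degree_mapDomain]

/-- The action of a group `G` on `ℝ[x₁,…,xₙ]_{≤ k}` by permuting the variables,
`g · x_i = x_{g(i)}`. -/
def polyRep (G : Type*) [Group G] (n : ℕ) [MulAction G (Fin n)] (k : ℤ) :
    Representation ℝ G (polyLE n k) where
  toFun g := (rename (R := ℝ) (fun i : Fin n => g • i)).toLinearMap.restrict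
    fun _ hp => rename_mem_polyLE _ hp
  map_one' := by
    ext1 p
    apply Subtype.ext
    simp [LinearMap.restrict_apply, ← Function.id_def]
  map_mul' g h := by
    ext1 p
    apply Subtype.ext
    exact (congrArg (fun f => rename f (p : MvPolynomial (Fin n) ℝ))
      (funext fun i => mul_smul g h i)).trans (rename_rename _ _ _).symm

/-- `(u i j)` is a representative set for the representation `ρ` on `V`: there is a decomposition
`V = ⨁ᵢ ⨁ⱼ W i j` into irreducible subrepresentations, with `W i j` and `W i' j'` isomorphic only
if `i = i'`, such that `u i j` is a nonzero vector of `W i j` and for all `i`, `j`, `j'` some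
isomorphism `W i j ≃ W i j'` sends `u i j` to `u i j'`. Multiplicities `m i = 0` are allowed, so
that the index set may list irreducible types that do not occur in `V`. -/
def IsRepresentativeSet {F G V ι : Type*} [Field F] [Group G] [AddCommGroup V] [Module F V]
    (ρ : Representation F G V) (m : ι → ℕ) (u : (i : ι) → Fin (m i) → V) : Prop :=
  ∃ (W : (i : ι) → Fin (m i) → Subrepresentation ρ) (hu : ∀ i j, u i j ∈ (W i j).toSubmodule),
    iSupIndep (fun s : (i : ι) × Fin (m i) => (W s.1 s.2).toSubmodule) ∧
    (⨆ s : (i : ι) × Fin (m i), (W s.1 s.2).toSubmodule) = ⊤ ∧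
    (∀ i j, (W i j).toRepresentation.IsIrreducible) ∧
    (∀ i i', i ≠ i' → ∀ j j',
      IsEmpty ((W i j).toRepresentation.Equiv (W i' j').toRepresentation)) ∧
    (∀ i j, u i j ≠ 0) ∧
    (∀ i j j', ∃ φ : (W i j).toRepresentation.Equiv (W i j').toRepresentation,
      φ ⟨u i j, hu i j⟩ = ⟨u i j', hu i j'⟩)

/-- `𝒮_G(f) = ∑_{g ∈ G} g · f`. -/
def orbitSum (G : Type*) [Group G] [Fintype G] {n : ℕ} [MulAction G (Fin n)]
    (f : MvPolynomial (Fin n) ℝ) : MvPolynomial (Fin n) ℝ :=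
  ∑ g : G, rename (fun i : Fin n => g • i) f

/-- The matrix `(𝒮_G(u_a u_b))_{a,b}` of orbit sums of products. -/
def orbitMatrix (G : Type*) [Group G] [Fintype G] {n m : ℕ} [MulAction G (Fin n)] {k : ℤ}
    (u : Fin m → polyLE n k) : Matrix (Fin m) (Fin m) (MvPolynomial (Fin n) ℝ) :=
  Matrix.of fun a b => orbitSum G ((u a : MvPolynomial (Fin n) ℝ) * (u b))

/-- `⟨Q, X⟩ = ∑_{a,b} Q_{ab} X_{ab}` for a real matrix `Q` and a matrix `X` of polynomials. -/
def pairing {n m : ℕ} (Q : Matrix (Fin m) (Fin m) ℝ)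
    (X : Matrix (Fin m) (Fin m) (MvPolynomial (Fin n) ℝ)) : MvPolynomial (Fin n) ℝ :=
  ∑ a, ∑ b, Q a b • X a b

/-- The polynomial `x_i - x_i²`. -/
def cubeGen {n : ℕ} (i : Fin n) : MvPolynomial (Fin n) ℝ := X i - X i ^ 2

/-- The truncated quadratic module `M_{n,r}(x₁ - x₁², …, xₙ - xₙ²)`. -/
def truncQuadModule (n : ℕ) (r : ℤ) : Set (MvPolynomial (Fin n) ℝ) :=
  {p | ∃ (σ₀ : MvPolynomial (Fin n) ℝ) (σ : Fin n → MvPolynomial (Fin n) ℝ),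
    IsSumSq σ₀ ∧ σ₀ ∈ polyLE n r ∧ (∀ i, IsSumSq (σ i) ∧ σ i ∈ polyLE n (r - 2)) ∧
    p = σ₀ + ∑ i, σ i * cubeGen i}

/-- The index of the last variable `xₙ`. -/
def lastVar (n : ℕ) (hn : 0 < n) : Fin n := ⟨n - 1, Nat.sub_one_lt_of_lt hn⟩

/-- The group `S_{n-1}` of permutations of the variables that fix `xₙ`. -/
abbrev StabLast (n : ℕ) (hn : 0 < n) : Subgroup (Equiv.Perm (Fin n)) :=
  MulAction.stabilizer (Equiv.Perm (Fin n)) (lastVar n hn)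

end

end HypercubeSDP

namespace HypercubeSDP

/-- Every permutation `g` is inverted by a permutation that fixes a given point and all fixed
points of `g`. -/
theorem exists_perm_conj_eq_inv {α : Type*} (g : Equiv.Perm α) (a : α) :
    ∃ h : Equiv.Perm α, h a = a ∧ h * g * h⁻¹ = g⁻¹ ∧ ∀ x, g x = x → h x = x := by
  classical
  obtain ⟨r, hr, hrr, hra⟩ : ∃ r : α → α, (∀ x, g.SameCycle (r x) x) ∧
      (∀ x y, g.SameCycle x y → r x = r y) ∧ r a = a := by
    refine ⟨fun x => if g.SameCycle a x then a else
      (Quotient.mk (Equiv.Perm.SameCycle.setoid g) x).out, fun x => ?_, fun x y hxy => ?_, ?_⟩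
    · by_cases hx : g.SameCycle a x
      · simp [hx]
      · simp only [hx, if_false]
        exact Quotient.exact (s := Equiv.Perm.SameCycle.setoid g) (Quotient.out_eq _)
    · have hiff : g.SameCycle a x ↔ g.SameCycle a y :=
        ⟨fun h => h.trans hxy, fun h => h.trans hxy.symm⟩
      have hq : Quotient.mk (Equiv.Perm.SameCycle.setoid g) x = Quotient.mk _ y :=
        Quotient.sound hxy
      simp only [hiff, hq]
    · exact if_pos (Equiv.Perm.SameCycle.refl g a)
  choose i hi using hr
  have key : ∀ (x : α) (z : ℤ), (g ^ (-i ((g ^ z) (r x)))) (r ((g ^ z) (r x)))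
      = (g ^ (-z)) (r x) := by
    intro x z
    have h1 : r ((g ^ z) (r x)) = r x := by
      refine hrr _ _ ?_
      have h2 : g.SameCycle (r x) ((g ^ z) (r x)) := ⟨z, rfl⟩
      exact h2.symm.trans ⟨i x, hi x⟩
    have h3 := hi ((g ^ z) (r x))
    rw [h1] at h3 ⊢
    generalize i ((g ^ z) (r x)) = k at h3 ⊢
    have h4 := congrArg (g ^ (-k - z)) h3
    rw [← Equiv.Perm.mul_apply, ← Equiv.Perm.mul_apply, ← zpow_add, ← zpow_add] at h4
    rw [show -k - z + k = -z by ring, show -k - z + z = -k by ring] at h4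
    exact h4.symm
  have hinv : Function.Involutive fun x => (g ^ (-i x)) (r x) := by
    intro x
    have := key x (-i x)
    rw [neg_neg, hi] at this
    exact this
  refine ⟨hinv.toPerm, ?_, ?_, fun x hx => ?_⟩
  · have := key a 0
    simpa [hra] using this
  · rw [mul_inv_eq_iff_eq_mul]
    ext x
    have h1 := key x (1 + i x)
    rw [zpow_add, zpow_one, Equiv.Perm.mul_apply, hi, neg_add, zpow_add, zpow_neg_one] at h1
    exact h1
  · have h0 : r x = x := by
      have h1 := hi x
      have h2 : (g ^ (-i x)) x = x := Equiv.Perm.zpow_apply_eq_self_of_apply_eq_self hx _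
      generalize i x = k at h1 h2
      have h3 := congrArg (g ^ (-k)) h1
      rwa [h2, ← Equiv.Perm.mul_apply, ← zpow_add, neg_add_cancel, zpow_zero] at h3
    have := key x 0
    simpa [h0] using this

section Operators

variable {G V : Type*} [Group G] [NormedAddCommGroup V] [InnerProductSpace ℝ V]

/-- The algebra of operators generated by a subgroup. -/
def groupImage (ρ : Representation ℝ G V) (H : Subgroup G) : Subalgebra ℝ (Module.End ℝ V) :=
  Algebra.adjoin ℝ (ρ '' H)

theorem mem_groupImage {ρ : Representation ℝ G V} {H : Subgroup G} {g : G} (hg : g ∈ H) :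
    ρ g ∈ groupImage ρ H :=
  Algebra.subset_adjoin ⟨g, hg, rfl⟩

theorem groupImage_toSubmodule (ρ : Representation ℝ G V) (H : Subgroup G) :
    Subalgebra.toSubmodule (groupImage ρ H) = Submodule.span ℝ (ρ '' H) := by
  have h : (ρ '' H : Set (Module.End ℝ V)) = (H.toSubmonoid.map ρ : Submonoid _) := rfl
  rw [groupImage, Algebra.adjoin_eq_span, h, Submonoid.closure_eq]

theorem groupImage_induction {ρ : Representation ℝ G V} {H : Subgroup G}
    {S : Submodule ℝ (Module.End ℝ V)} (hS : ∀ h ∈ H, ρ h ∈ S) {a : Module.End ℝ V}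
    (ha : a ∈ groupImage ρ H) : a ∈ S := by
  have h1 : a ∈ Submodule.span ℝ (ρ '' H) := by
    rw [← groupImage_toSubmodule]; exact ha
  refine (Submodule.span_le.mpr ?_) h1
  rintro _ ⟨h, hh, rfl⟩
  exact hS h hh

theorem groupImage_mono (ρ : Representation ℝ G V) {H K : Subgroup G} (h : H ≤ K) :
    groupImage ρ H ≤ groupImage ρ K :=
  Algebra.adjoin_mono (Set.image_mono h)

/-- A symmetric element `P` of the operator algebra `A` of a subgroup with `P A P ⊆ ℝ P`. -/
structure IsPrimitive (ρ : Representation ℝ G V) (H : Subgroup G) (P : Module.End ℝ V) :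
    Prop where
  mem : P ∈ groupImage ρ H
  symm : LinearMap.IsSymmetric P
  corner : ∀ h ∈ H, ∃ c : ℝ, P * ρ h * P = c • P

/-- The symmetric operators, as a real subspace. -/
def symmetricOperators (V : Type*) [NormedAddCommGroup V] [InnerProductSpace ℝ V] :
    Submodule ℝ (Module.End ℝ V) where
  carrier := {T | LinearMap.IsSymmetric T}
  add_mem' := fun h₁ h₂ => LinearMap.IsSymmetric.add h₁ h₂
  zero_mem' := LinearMap.IsSymmetric.zero
  smul_mem' := fun c _ hT => LinearMap.IsSymmetric.smul (by simp) hT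

variable {ρ : Representation ℝ G V}

theorem inner_rep_left (hρ : ∀ g x y, inner ℝ (ρ g x) (ρ g y) = inner ℝ x y)
    (g : G) (x y : V) : inner ℝ (ρ g x) y = inner ℝ x (ρ g⁻¹ y) := by
  rw [← hρ g x (ρ g⁻¹ y), ← Module.End.mul_apply (ρ g) (ρ g⁻¹), ← map_mul]
  simp

/-- If every element of `K` is inverted by an element of `H`, then averages over `H` of elements
of the operator algebra of `K` are symmetric. -/
theorem isSymmetric_sum_conj (hρ : ∀ g x y, inner ℝ (ρ g x) (ρ g y) = inner ℝ x y)
    [Fintype G] {H K : Subgroup G} [DecidablePred (· ∈ H)]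
    (hinv : ∀ g ∈ K, ∃ h ∈ H, h * g * h⁻¹ = g⁻¹) {a : Module.End ℝ V}
    (ha : a ∈ groupImage ρ K) :
    LinearMap.IsSymmetric (∑ h : H, ρ h * a * ρ (h : G)⁻¹) := by
  let F : Module.End ℝ V →ₗ[ℝ] Module.End ℝ V :=
    ∑ h : H, LinearMap.mulLeft ℝ (ρ h) ∘ₗ LinearMap.mulRight ℝ (ρ (h : G)⁻¹)
  have hF : ∀ b, F b = ∑ h : H, ρ h * b * ρ (h : G)⁻¹ := fun b => by
    simp [F, mul_assoc]
  suffices a ∈ (symmetricOperators V).comap F by rw [← hF]; exact this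
  refine groupImage_induction (fun g hg => ?_) ha
  change LinearMap.IsSymmetric (F (ρ g))
  rw [hF]
  obtain ⟨k, hk, hkg⟩ := hinv g hg
  intro x y
  simp only [LinearMap.sum_apply, sum_inner, inner_sum, ← map_mul]
  simp only [inner_rep_left hρ]
  refine Fintype.sum_equiv (Equiv.mulRight ⟨k, hk⟩) _ _ fun h => ?_
  have : ((h : G) * g * (h : G)⁻¹)⁻¹ = (h * k) * g * (h * k)⁻¹ := by
    rw [mul_inv_rev, mul_inv_rev, ← hkg]; group
  rw [this]; rfl

theorem IsPrimitive.corner_symmetric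
    (hρ : ∀ g x y, inner ℝ (ρ g x) (ρ g y) = inner ℝ x y)
    [Fintype G] {H K : Subgroup G} (hHK : H ≤ K)
    (hinv : ∀ g ∈ K, ∃ h ∈ H, h * g * h⁻¹ = g⁻¹) {P : Module.End ℝ V}
    (hP : IsPrimitive ρ H P) (hP0 : P ≠ 0) {a : Module.End ℝ V} (ha : a ∈ groupImage ρ K) :
    LinearMap.IsSymmetric (P * a * P) := by
  classical
  choose! τ hτ using hP.corner
  have hsq : P * P = τ 1 • P := by simpa using hτ 1 H.one_mem
  have hτ1 : τ 1 ≠ 0 := by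
    intro h0
    apply hP0
    ext x
    have h1 : P (P x) = 0 := by
      have := congrArg (fun T : Module.End ℝ V => T x) hsq
      simpa [h0] using this
    have h2 : inner ℝ (P x) (P x) = 0 := by rw [hP.symm, h1, inner_zero_right]
    simpa using h2
  have hτinv : ∀ h ∈ H, τ h⁻¹ = τ h := by
    intro h hh
    have h1 : (τ h⁻¹) • P = τ h • P := by
      ext x
      refine ext_inner_left ℝ fun y => ?_
      rw [← hτ h hh, ← hτ h⁻¹ (H.inv_mem hh)]
      have e1 : inner ℝ y ((P * ρ h⁻¹ * P) x) = inner ℝ ((P * ρ h * P) y) x := by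
        simp only [Module.End.mul_apply]
        rw [hP.symm, inner_rep_left hρ, hP.symm]
      rw [e1, hτ h hh, LinearMap.smul_apply, LinearMap.smul_apply, inner_smul_left, hP.symm,
        inner_smul_right]
      simp
    exact smul_left_injective ℝ hP0 h1
  have hsum : (∑ h : H, τ h * τ h) ≠ 0 := by
    refine (lt_of_lt_of_le (mul_self_pos.mpr hτ1) ?_).ne'
    exact Finset.single_le_sum (f := fun h : H => τ h * τ h)
      (fun h _ => mul_self_nonneg _) (Finset.mem_univ (1 : H))
  have hz := isSymmetric_sum_conj hρ (H := H) (K := K) hinv (a := P * a * P)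
    ((groupImage ρ K).mul_mem ((groupImage ρ K).mul_mem (groupImage_mono ρ hHK hP.mem) ha)
      (groupImage_mono ρ hHK hP.mem))
  have heq : (∑ h : H, τ h * τ h) • (P * a * P)
      = P * (∑ h : H, ρ h * (P * a * P) * ρ (h : G)⁻¹) * P := by
    rw [Finset.mul_sum, Finset.sum_mul, Finset.sum_smul]
    refine Finset.sum_congr rfl fun h _ => ?_
    have : P * (ρ h * (P * a * P) * ρ (h : G)⁻¹) * P
        = (P * ρ h * P) * a * (P * ρ (h : G)⁻¹ * P) := by noncomm_ring
    rw [this, hτ _ h.2, hτ _ (H.inv_mem h.2), hτinv _ h.2]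
    simp [mul_assoc, smul_smul]
  have hfin : P * a * P = (∑ h : H, τ h * τ h)⁻¹ •
      (P * (∑ h : H, ρ h * (P * a * P) * ρ (h : G)⁻¹) * P) := by
    rw [← heq, smul_smul, inv_mul_cancel₀ hsum, one_smul]
  rw [hfin]
  refine (symmetricOperators V).smul_mem _ fun x y => ?_
  simp only [Module.End.mul_apply]
  rw [hP.symm, hz, hP.symm]

end Operators

section Operators

variable {G V : Type*} [Group G] [NormedAddCommGroup V] [InnerProductSpace ℝ V]
  [FiniteDimensional ℝ V]

/-- A space of symmetric operators closed under products is spanned by its joint eigenvectors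
under left multiplication. -/
theorem mem_span_joint_eigenvectors (B : Submodule ℝ (Module.End ℝ V))
    (hsymm : ∀ x ∈ B, LinearMap.IsSymmetric x) (hmul : ∀ x ∈ B, ∀ y ∈ B, x * y ∈ B)
    {x : Module.End ℝ V} (hx : x ∈ B) :
    x ∈ Submodule.span ℝ {P | P ∈ B ∧ ∀ b ∈ B, ∃ c : ℝ, b * P = c • P} := by
  have hcomm : ∀ x ∈ B, ∀ y ∈ B, x * y = y * x := by
    intro x hx y hy
    ext v
    refine ext_inner_right ℝ fun w => ?_
    rw [hsymm _ (hmul x hx y hy), Module.End.mul_apply, Module.End.mul_apply, hsymm y hy,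
      hsymm x hx]
  let e := stdOrthonormalBasis ℝ V
  let core : InnerProductSpace.Core ℝ B :=
    { inner := fun x y => ∑ i, inner ℝ (x.1 (e i)) (y.1 (e i))
      conj_inner_symm := fun x y => by simp [real_inner_comm]
      re_inner_nonneg := fun x => by
        simpa using Finset.sum_nonneg fun i _ => real_inner_self_nonneg (x := x.1 (e i))
      add_left := fun x y z => by simp [inner_add_left, Finset.sum_add_distrib]
      smul_left := fun x y r => by simp [inner_smul_left, Finset.mul_sum]
      definite := fun x hx => by
        have h1 := (Finset.sum_eq_zero_iff_of_nonneg
          fun i _ => real_inner_self_nonneg (x := x.1 (e i))).mp hx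
        apply Subtype.ext
        refine e.toBasis.ext fun i => ?_
        simpa using h1 i (Finset.mem_univ i) }
  let : NormedAddCommGroup B := core.toNormedAddCommGroup
  let : InnerProductSpace ℝ B := InnerProductSpace.ofCore core.toCore
  let T : B → (B →ₗ[ℝ] B) := fun b =>
    (LinearMap.mulLeft ℝ b.1).restrict fun y hy => hmul b.1 b.2 y hy
  have hT : ∀ b, (T b).IsSymmetric := fun b y z => by
    change ∑ i, inner ℝ ((b.1 * y.1) (e i)) (z.1 (e i))
      = ∑ i, inner ℝ (y.1 (e i)) ((b.1 * z.1) (e i))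
    exact Finset.sum_congr rfl fun i _ => hsymm b.1 b.2 _ _
  have hTc : Pairwise (Function.onFun Commute T) := fun b c _ => by
    refine LinearMap.ext fun y => Subtype.ext ?_
    change b.1 * (c.1 * y.1) = c.1 * (b.1 * y.1)
    rw [← mul_assoc, ← mul_assoc, hcomm _ b.2 _ c.2]
  have htop := LinearMap.IsSymmetric.iSup_iInf_eq_top_of_commute hT hTc
  have hle : (⨆ χ : B → ℝ, ⨅ b, Module.End.eigenspace (T b) (χ b)) ≤
      (Submodule.span ℝ {P | P ∈ B ∧ ∀ b ∈ B, ∃ c : ℝ, b * P = c • P}).comap B.subtype := by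
    refine iSup_le fun χ y hy => Submodule.subset_span ⟨y.2, fun b hb => ⟨χ ⟨b, hb⟩, ?_⟩⟩
    have h1 := (Submodule.mem_iInf _).mp hy ⟨b, hb⟩
    rw [Module.End.mem_eigenspace_iff] at h1
    exact congrArg Subtype.val h1
  rw [htop] at hle
  exact hle (x := ⟨x, hx⟩) trivial

variable {ρ : Representation ℝ G V}

theorem IsPrimitive.mem_span_isPrimitive
    (hρ : ∀ g x y, inner ℝ (ρ g x) (ρ g y) = inner ℝ x y)
    [Fintype G] {H K : Subgroup G} (hHK : H ≤ K)
    (hinv : ∀ g ∈ K, ∃ h ∈ H, h * g * h⁻¹ = g⁻¹) {P : Module.End ℝ V}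
    (hP : IsPrimitive ρ H P) : P ∈ Submodule.span ℝ {P | IsPrimitive ρ K P} := by
  by_cases hP0 : P = 0
  · rw [hP0]; exact Submodule.zero_mem _
  obtain ⟨t, hsq⟩ : ∃ t : ℝ, P * P = t • P := by simpa using hP.corner 1 H.one_mem
  have ht : t ≠ 0 := by
    rintro rfl
    apply hP0
    ext x
    have h1 : P (P x) = 0 := by
      have := congrArg (fun T : Module.End ℝ V => T x) hsq
      simpa using this
    have h2 : inner ℝ (P x) (P x) = 0 := by rw [hP.symm, h1, inner_zero_right]
    simpa using h2
  have hPK := groupImage_mono ρ hHK hP.mem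
  let B : Submodule ℝ (Module.End ℝ V) := (Subalgebra.toSubmodule (groupImage ρ K)).map
    (LinearMap.mulLeft ℝ P ∘ₗ LinearMap.mulRight ℝ P)
  have hB : ∀ a ∈ groupImage ρ K, P * a * P ∈ B := fun a ha =>
    ⟨a, ha, by simp [mul_assoc]⟩
  have hB' : ∀ x ∈ B, ∃ a ∈ groupImage ρ K, x = P * a * P := by
    rintro _ ⟨a, ha, rfl⟩
    exact ⟨a, ha, by simp [mul_assoc]⟩
  have hBK : ∀ x ∈ B, x ∈ groupImage ρ K := by
    intro x hx
    obtain ⟨a, ha, rfl⟩ := hB' x hx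
    exact mul_mem (mul_mem hPK ha) hPK
  have hsymm : ∀ x ∈ B, LinearMap.IsSymmetric x := by
    intro x hx
    obtain ⟨a, ha, rfl⟩ := hB' x hx
    exact hP.corner_symmetric hρ hHK hinv hP0 ha
  have hmul : ∀ x ∈ B, ∀ y ∈ B, x * y ∈ B := by
    intro x hx y hy
    obtain ⟨a, ha, rfl⟩ := hB' x hx
    obtain ⟨b, hb, rfl⟩ := hB' y hy
    have := hB (a * P * P * b) (mul_mem (mul_mem (mul_mem ha hPK) hPK) hb)
    simpa only [mul_assoc] using this
  have hPB : P ∈ B := by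
    have h1 := B.smul_mem t⁻¹ (hB 1 (one_mem _))
    rwa [mul_one, hsq, smul_smul, inv_mul_cancel₀ ht, one_smul] at h1
  refine (Submodule.span_mono ?_) (mem_span_joint_eigenvectors B hsymm hmul hPB)
  rintro x ⟨hx, hxe⟩
  refine ⟨hBK x hx, hsymm x hx, fun k hk => ?_⟩
  obtain ⟨a, ha, hxa⟩ := hB' x hx
  have hl : x = t⁻¹ • (P * x) := by
    have : P * x = t • x := by rw [hxa, ← mul_assoc, ← mul_assoc, hsq]; simp
    rw [this, smul_smul, inv_mul_cancel₀ ht, one_smul]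
  have hr : x = t⁻¹ • (x * P) := by
    have : x * P = t • x := by rw [hxa, mul_assoc, hsq]; simp
    rw [this, smul_smul, inv_mul_cancel₀ ht, one_smul]
  obtain ⟨c, hc⟩ := hxe (P * ρ k * P) (hB _ (mem_groupImage hk))
  obtain ⟨c', hc'⟩ := hxe x hx
  refine ⟨t⁻¹ * t⁻¹ * c * c', ?_⟩
  calc x * ρ k * x = (t⁻¹ • (x * P)) * ρ k * (t⁻¹ • (P * x)) := by rw [← hl, ← hr]
    _ = (t⁻¹ * t⁻¹) • (x * (P * ρ k * P * x)) := by
        simp [mul_assoc, smul_smul]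
    _ = (t⁻¹ * t⁻¹ * c * c') • x := by
        rw [hc, mul_smul_comm, hc', smul_smul, smul_smul, mul_assoc]

end Operators

/-- An increasing chain of subgroups from the trivial group to the whole group, in which every
element of each member is inverted by an element of the previous member. -/
def HasInvertingChain (G : Type*) [Group G] : Prop :=
  ∃ (N : ℕ) (H : ℕ → Subgroup G), H 0 = ⊥ ∧ H N = ⊤ ∧ Monotone H ∧
    ∀ k, ∀ g ∈ H (k + 1), ∃ h ∈ H k, h * g * h⁻¹ = g⁻¹

theorem hasInvertingChain_of_action {G : Type*} [Group G] {n : ℕ} [MulAction G (Fin n)]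
    [FaithfulSMul G (Fin n)]
    (h : ∀ (g : G) (a : Fin n), ∃ h : G, h • a = a ∧ h * g * h⁻¹ = g⁻¹ ∧
      ∀ x : Fin n, g • x = x → h • x = x) : HasInvertingChain G := by
  refine ⟨n, fun k => fixingSubgroup G {i : Fin n | k ≤ (i : ℕ)}, ?_, ?_, ?_, ?_⟩
  · rw [eq_bot_iff]
    intro g hg
    rw [mem_fixingSubgroup_iff] at hg
    exact FaithfulSMul.eq_of_smul_eq_smul (α := Fin n) fun i => by
      rw [hg i (Nat.zero_le _), one_smul]
  · rw [eq_top_iff]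
    intro g _
    rw [mem_fixingSubgroup_iff]
    intro i hi
    exact absurd i.2 (not_lt.mpr hi)
  · intro k l hkl g hg
    rw [mem_fixingSubgroup_iff] at hg ⊢
    exact fun i hi => hg i (le_trans hkl hi)
  · intro k g hg
    rw [mem_fixingSubgroup_iff] at hg
    by_cases hk : k < n
    · obtain ⟨x, hx1, hx2, hx3⟩ := h g ⟨k, hk⟩
      refine ⟨x, ?_, hx2⟩
      rw [mem_fixingSubgroup_iff]
      intro i hi
      rcases (show k ≤ (i : ℕ) from hi).eq_or_lt with h1 | h1
      · rwa [show i = ⟨k, hk⟩ from Fin.ext h1.symm]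
      · exact hx3 i (hg i h1)
    · obtain rfl | hn := Nat.eq_zero_or_pos n
      · exact ⟨1, one_mem _, by
          refine FaithfulSMul.eq_of_smul_eq_smul (α := Fin 0) fun i => i.elim0⟩
      · obtain ⟨x, hx1, hx2, hx3⟩ := h g ⟨0, hn⟩
        refine ⟨x, ?_, hx2⟩
        rw [mem_fixingSubgroup_iff]
        intro i hi
        exact absurd i.2 (not_lt.mpr ((not_lt.mp hk).trans hi))

theorem hasInvertingChain_perm (n : ℕ) : HasInvertingChain (Equiv.Perm (Fin n)) :=
  hasInvertingChain_of_action exists_perm_conj_eq_inv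

theorem hasInvertingChain_stabilizer {n : ℕ} (i : Fin n) :
    HasInvertingChain (MulAction.stabilizer (Equiv.Perm (Fin n)) i) :=
  hasInvertingChain_of_action fun g a => by
    obtain ⟨h, h1, h2, h3⟩ := exists_perm_conj_eq_inv (g : Equiv.Perm (Fin n)) a
    exact ⟨⟨h, h3 i g.2⟩, h1, Subtype.ext h2, h3⟩

/-- Schur's lemma over `ℝ`: for groups with an inverting chain, the operators commuting with an
irreducible orthogonal representation are scalars. -/
theorem eq_smul_of_commute {G V : Type*} [Group G] [Fintype G] [NormedAddCommGroup V]
    [InnerProductSpace ℝ V] [FiniteDimensional ℝ V] (hG : HasInvertingChain G) (ρ : Representation ℝ G V)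
    (hρ : ∀ g x y, inner ℝ (ρ g x) (ρ g y) = inner ℝ x y) (hirr : ρ.IsIrreducible)
    (T : Module.End ℝ V) (hT : ∀ g, T * ρ g = ρ g * T) :
    ∃ c : ℝ, ∀ x, T x = c • x := by
  obtain ⟨N, H, h0, hN, hmono, hinv⟩ := hG
  have hspan : ∀ k, (1 : Module.End ℝ V) ∈ Submodule.span ℝ {P | IsPrimitive ρ (H k) P} := by
    intro k
    induction k with
    | zero =>
      refine Submodule.subset_span ⟨one_mem _, LinearMap.IsSymmetric.one, fun h hh => ⟨1, ?_⟩⟩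
      rw [h0, Subgroup.mem_bot] at hh
      simp [hh]
    | succ k ih =>
      exact (Submodule.span_le.mpr fun P hP =>
        IsPrimitive.mem_span_isPrimitive hρ (hmono k.le_succ) (hinv k) hP) ih
  have htopmem : ∀ (S : Submodule ℝ V), S ≠ ⊥ → (∀ g, ∀ x ∈ S, ρ g x ∈ S) → S = ⊤ := by
    intro S hS hS'
    have := hirr.eq_bot_or_eq_top ⟨S, hS'⟩
    rcases this with h | h
    · exact absurd (congrArg Subrepresentation.toSubmodule h) hS
    · exact congrArg Subrepresentation.toSubmodule h
  have hnt : ∃ x : V, x ≠ 0 := by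
    by_contra! hall
    refine (bot_ne_top (α := Subrepresentation ρ)) ?_
    ext x
    rw [hall x]
    exact ⟨fun _ => trivial, fun _ => (⊥ : Submodule ℝ V).zero_mem⟩
  obtain ⟨P, hP, hP0⟩ : ∃ P, IsPrimitive ρ ⊤ P ∧ P ≠ 0 := by
    by_contra! hall
    have h1 := hspan N
    rw [hN] at h1
    have h2 : Submodule.span ℝ {P | IsPrimitive ρ ⊤ P} ≤ ⊥ := Submodule.span_le.mpr hall
    obtain ⟨x, hx⟩ := hnt
    exact hx (congrArg (fun S : Module.End ℝ V => S x) ((Submodule.mem_bot ℝ).mp (h2 h1)))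
  obtain ⟨w, hw⟩ : ∃ w, P w ≠ 0 := by
    by_contra! hall
    exact hP0 (LinearMap.ext hall)
  have hline : ∀ x, P x ∈ Submodule.span ℝ {P w} := by
    have h1 := htopmem (Submodule.span ℝ (Set.range fun g => ρ g (P w))) ?_ ?_
    · intro x
      have hx : x ∈ Submodule.span ℝ (Set.range fun g => ρ g (P w)) := by rw [h1]; trivial
      refine (Submodule.span_le (p := (Submodule.span ℝ {P w}).comap P)).mpr ?_ hx
      rintro _ ⟨g, rfl⟩
      obtain ⟨c, hc⟩ := hP.corner g trivial
      exact Submodule.mem_span_singleton.mpr ⟨c, (congrArg (fun T => T w) hc).symm⟩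
    · intro hbot
      have : P w ∈ Submodule.span ℝ (Set.range fun g => ρ g (P w)) :=
        Submodule.subset_span ⟨1, by simp⟩
      rw [hbot] at this
      exact hw this
    · intro g x hx
      refine (Submodule.span_le (p := (Submodule.span ℝ _).comap (ρ g))).mpr ?_ hx
      rintro _ ⟨h, rfl⟩
      exact Submodule.subset_span ⟨g * h, by simp⟩
  have hTP : ∀ a ∈ groupImage ρ ⊤, T * a = a * T := by
    intro a ha
    have := groupImage_induction (ρ := ρ) (H := ⊤)
      (S := LinearMap.ker (LinearMap.mulLeft ℝ T - LinearMap.mulRight ℝ T))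
      (fun g _ => by simp [hT g]) ha
    simpa [sub_eq_zero] using this
  obtain ⟨c, hc⟩ := Submodule.mem_span_singleton.mp (hline (T w))
  have hTw : T (P w) = c • P w := by
    rw [hc]; exact congrArg (fun S => S w) (hTP P hP.mem)
  refine ⟨c, fun x => ?_⟩
  have h1 := htopmem (Module.End.eigenspace T c) ?_ ?_
  · have : x ∈ Module.End.eigenspace T c := by rw [h1]; trivial
    exact Module.End.mem_eigenspace_iff.mp this
  · intro hbot
    have : P w ∈ Module.End.eigenspace T c := Module.End.mem_eigenspace_iff.mpr hTw
    rw [hbot] at this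
    exact hw this
  · intro g x hx
    rw [Module.End.mem_eigenspace_iff] at hx ⊢
    rw [← Module.End.mul_apply, hT, Module.End.mul_apply, hx, map_smul]

section Forms

variable {G V : Type*} [Group G] [AddCommGroup V] [Module ℝ V]

/-- A symmetric positive definite bilinear form invariant under the representation `ρ`. -/
structure IsInvariantInner (ρ : Representation ℝ G V) (β : LinearMap.BilinForm ℝ V) : Prop where
  invariant : ∀ g x y, β (ρ g x) (ρ g y) = β x y
  symm : ∀ x y, β x y = β y x
  pos : ∀ x, x ≠ 0 → 0 < β x x

variable {ρ : Representation ℝ G V} {β : LinearMap.BilinForm ℝ V}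

theorem IsInvariantInner.nonneg (hβ : IsInvariantInner ρ β) (x : V) : 0 ≤ β x x := by
  by_cases hx : x = 0
  · simp [hx]
  · exact (hβ.pos x hx).le

theorem IsInvariantInner.nondegenerate (hβ : IsInvariantInner ρ β) : β.Nondegenerate := by
  refine ⟨fun x hx => ?_, fun x hx => ?_⟩ <;>
  · by_contra h0
    exact (hβ.pos x h0).ne' (hx x)

theorem IsInvariantInner.smul_right (hβ : IsInvariantInner ρ β) (g : G) (x y : V) :
    β x (ρ g y) = β (ρ g⁻¹ x) y := by
  rw [← hβ.invariant g (ρ g⁻¹ x) y, ← Module.End.mul_apply (ρ g) (ρ g⁻¹), ← map_mul]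
  simp

theorem exists_isInvariantInner [Fintype G] [FiniteDimensional ℝ V] (ρ : Representation ℝ G V) :
    ∃ β, IsInvariantInner ρ β := by
  let e : V ≃ₗ[ℝ] EuclideanSpace ℝ (Fin (Module.finrank ℝ V)) :=
    LinearEquiv.ofFinrankEq _ _ (by simp)
  let β : LinearMap.BilinForm ℝ V :=
    ∑ g : G, (innerₗ (EuclideanSpace ℝ (Fin (Module.finrank ℝ V)))).compl₁₂
      (e.toLinearMap ∘ₗ ρ g) (e.toLinearMap ∘ₗ ρ g)
  have hβ : ∀ x y, β x y = ∑ g : G, inner ℝ (e (ρ g x)) (e (ρ g y)) := fun x y => by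
    simp [β, LinearMap.sum_apply]
  refine ⟨β, fun g x y => ?_, fun x y => ?_, fun x hx => ?_⟩
  · rw [hβ, hβ]
    refine Fintype.sum_equiv (Equiv.mulRight g) _ _ fun h => ?_
    simp
  · rw [hβ, hβ]
    exact Finset.sum_congr rfl fun g _ => real_inner_comm _ _
  · rw [hβ]
    refine Finset.sum_pos' (fun g _ => real_inner_self_nonneg) ⟨1, Finset.mem_univ _, ?_⟩
    rw [real_inner_self_pos]
    simpa using hx

/-- Schur's lemma for invariant bilinear forms: for groups with an inverting chain, invariant forms
on an irreducible real representation are unique up to a scalar. -/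
theorem IsInvariantInner.eq_smul [Fintype G] [FiniteDimensional ℝ V] (hG : HasInvertingChain G)
    (hβ : IsInvariantInner ρ β) (hirr : ρ.IsIrreducible) (b : LinearMap.BilinForm ℝ V)
    (hb : ∀ g x y, b (ρ g x) (ρ g y) = b x y) : ∃ c : ℝ, ∀ x y, b x y = c * β x y := by
  let core : InnerProductSpace.Core ℝ V :=
    { inner := fun x y => β x y
      conj_inner_symm := fun x y => hβ.symm y x
      re_inner_nonneg := hβ.nonneg
      add_left := fun x y z => by simp
      smul_left := fun x y r => by simp
      definite := fun x hx => by
        by_contra h0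
        exact (hβ.pos x h0).ne' hx }
  let : NormedAddCommGroup V := core.toNormedAddCommGroup
  let : InnerProductSpace ℝ V := InnerProductSpace.ofCore core.toCore
  let T : Module.End ℝ V := (β.toDual hβ.nondegenerate).symm.toLinearMap ∘ₗ b
  have hT : ∀ x y, β (T x) y = b x y := fun x y =>
    LinearMap.BilinForm.apply_toDual_symm_apply (hB := hβ.nondegenerate) (b x) y
  obtain ⟨c, hc⟩ := eq_smul_of_commute hG ρ hβ.invariant hirr T fun g => by
    refine LinearMap.ext fun x => (β.toDual hβ.nondegenerate).injective (LinearMap.ext fun y => ?_)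
    change β (T (ρ g x)) y = β (ρ g (T x)) y
    have h := hβ.smul_right g⁻¹ (T x) y
    rw [inv_inv] at h
    rw [← h, hT, hT, ← hb g x (ρ g⁻¹ y)]
    simp
  exact ⟨c, fun x y => by rw [← hT, hc]; simp⟩

theorem eq_zero_of_isEmpty_equiv [Fintype G] {W : Type*} [AddCommGroup W] [Module ℝ W]
    [FiniteDimensional ℝ W] {σ : Representation ℝ G W} (hρ : ρ.IsIrreducible)
    (hσ : σ.IsIrreducible) (h : IsEmpty (ρ.Equiv σ)) (b : V →ₗ[ℝ] W →ₗ[ℝ] ℝ)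
    (hb : ∀ g x y, b (ρ g x) (σ g y) = b x y) (x : V) (y : W) : b x y = 0 := by
  obtain ⟨β, hβ⟩ := exists_isInvariantInner σ
  let T : V →ₗ[ℝ] W := (β.toDual hβ.nondegenerate).symm.toLinearMap ∘ₗ b
  have hT : ∀ x y, β (T x) y = b x y := fun x y =>
    LinearMap.BilinForm.apply_toDual_symm_apply (hB := hβ.nondegenerate) (b x) y
  let S : ρ.IntertwiningMap σ := T.intertwiningMap_of_isIntertwiningMap ρ σ fun g x => by
    refine (β.toDual hβ.nondegenerate).injective (LinearMap.ext fun y => ?_)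
    change β (T (ρ g x)) y = β (σ g (T x)) y
    have h := hβ.smul_right g⁻¹ (T x) y
    rw [inv_inv] at h
    rw [← h, hT, hT, ← hb g x (σ g⁻¹ y)]
    simp
  have hS : S = 0 := Subsingleton.elim _ _
  have hTx : T x = 0 := congrArg (fun f : ρ.IntertwiningMap σ => f x) hS
  rw [← hT, hTx]
  simp

end Forms

section Gram

variable {G V X : Type*} [Group G] [Fintype G] [AddCommGroup V] [Module ℝ V]
  [FiniteDimensional ℝ V] [AddCommGroup X] [Module ℝ X] {ρ : Representation ℝ G V}

theorem exists_gram_matrix (hG : HasInvertingChain G) (B : V →ₗ[ℝ] V →ₗ[ℝ] X)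
    (hB : ∀ g x y, B (ρ g x) (ρ g y) = B x y) {m : ℕ} (W : Fin m → Subrepresentation ρ)
    (hirr : ∀ j, (W j).toRepresentation.IsIrreducible)
    (u : Fin m → V) (hu : ∀ j, u j ∈ (W j).toSubmodule) (hu0 : ∀ j, u j ≠ 0)
    (hφ : ∀ j j', ∃ φ : (W j).toRepresentation.Equiv (W j').toRepresentation,
      φ ⟨u j, hu j⟩ = ⟨u j', hu j'⟩)
    (f : Fin m → V) (hf : ∀ j, f j ∈ (W j).toSubmodule) :
    ∃ Q : Matrix (Fin m) (Fin m) ℝ, Q.PosSemidef ∧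
      ∀ j j', B (f j) (f j') = Q j j' • B (u j) (u j') := by
  obtain rfl | hm := Nat.eq_zero_or_pos m
  · exact ⟨0, Matrix.PosSemidef.zero, fun j => j.elim0⟩
  let o : Fin m := ⟨0, hm⟩
  choose φ hφ using hφ o
  obtain ⟨β, hβ⟩ := exists_isInvariantInner (W o).toRepresentation
  let e : (W o).toSubmodule := ⟨u o, hu o⟩
  have he : 0 < β e e := hβ.pos e fun h => hu0 o (congrArg Subtype.val h)
  choose w hw using fun j => EquivLike.surjective (φ j) ⟨f j, hf j⟩
  refine ⟨Matrix.of fun j j' => β (w j) (w j') / β e e, ?_, fun j j' => ?_⟩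
  · refine Matrix.PosSemidef.of_dotProduct_mulVec_nonneg ?_ fun x => ?_
    · ext j j'
      simp [hβ.symm (w j) (w j')]
    · have h1 : star x ⬝ᵥ (Matrix.of fun j j' => β (w j) (w j') / β e e).mulVec x
          = β (∑ j, x j • w j) (∑ j, x j • w j) / β e e := by
        simp only [dotProduct, Matrix.mulVec, Matrix.of_apply, map_sum, LinearMap.sum_apply,
          Finset.sum_div, Finset.mul_sum]
        rw [Finset.sum_comm]
        refine Finset.sum_congr rfl fun j _ => Finset.sum_congr rfl fun j' _ => ?_
        simp
        ring
      rw [h1]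
      exact div_nonneg (hβ.nonneg _) he.le
  · rw [← sub_eq_zero, ← Module.forall_dual_apply_eq_zero_iff ℝ]
    intro L
    let ι (j : Fin m) : (W o).toSubmodule →ₗ[ℝ] V :=
      (W j).toSubmodule.subtype ∘ₗ (φ j).toIntertwiningMap.toLinearMap
    have hι : ∀ j g x, ι j ((W o).toRepresentation g x) = ρ g (ι j x) := fun j g x =>
      congrArg Subtype.val (Representation.IntertwiningMap.isIntertwining _ _ (φ j).toIntertwiningMap g x)
    obtain ⟨c, hc⟩ := hβ.eq_smul hG (hirr o) ((B.compr₂ L).compl₁₂ (ι j) (ι j')) fun g x y => by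
      simp [hι, hB]
    have hιw : ∀ j, ι j (w j) = f j := fun j => congrArg Subtype.val (hw j)
    have hιe : ∀ j, ι j e = u j := fun j => congrArg Subtype.val (hφ j)
    have h1 := hc (w j) (w j')
    have h2 := hc e e
    simp only [LinearMap.compl₁₂_apply, LinearMap.compr₂_apply, hιw, hιe] at h1 h2
    rw [map_sub, map_smul, h1, h2, Matrix.of_apply, smul_eq_mul]
    field_simp
    ring

theorem IsRepresentativeSet.exists_posSemidef (hG : HasInvertingChain G)
    (B : V →ₗ[ℝ] V →ₗ[ℝ] X) (hB : ∀ g x y, B (ρ g x) (ρ g y) = B x y)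
    {ι : Type*} [Fintype ι] {m : ι → ℕ} {u : (i : ι) → Fin (m i) → V}
    (hu : IsRepresentativeSet ρ m u) (f : V) :
    ∃ Q : (i : ι) → Matrix (Fin (m i)) (Fin (m i)) ℝ, (∀ i, (Q i).PosSemidef) ∧
      B f f = ∑ i, ∑ a, ∑ b, Q i a b • B (u i a) (u i b) := by
  classical
  obtain ⟨W, hW, -, htop, hirr, hne, hu0, hφ⟩ := hu
  obtain ⟨x, hx, hxf⟩ := (Submodule.mem_iSup_iff_exists_finsupp _ f).mp
    (htop.ge (Submodule.mem_top (x := f)))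
  rw [Finsupp.sum_fintype _ _ fun _ => rfl, Fintype.sum_sigma] at hxf
  choose Q hQ hQB using fun i => exists_gram_matrix hG B hB (W i) (hirr i) (u i) (hW i) (hu0 i)
    (hφ i) (fun j => x ⟨i, j⟩) (fun j => hx ⟨i, j⟩)
  refine ⟨Q, hQ, ?_⟩
  have hoff : ∀ i i', i ≠ i' → ∀ j j', B (x ⟨i, j⟩) (x ⟨i', j'⟩) = 0 := by
    intro i i' hii j j'
    rw [← Module.forall_dual_apply_eq_zero_iff ℝ]
    intro L
    exact eq_zero_of_isEmpty_equiv (hirr i j) (hirr i' j') (hne i i' hii j j')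
      ((B.compr₂ L).compl₁₂ (W i j).toSubmodule.subtype (W i' j').toSubmodule.subtype)
      (fun g y z => congrArg L (hB g y z)) ⟨_, hx ⟨i, j⟩⟩ ⟨_, hx ⟨i', j'⟩⟩
  rw [← hxf]
  simp only [map_sum, LinearMap.sum_apply]
  refine Finset.sum_congr rfl fun i _ => ?_
  rw [Finset.sum_comm (f := fun a b => Q i a b • B (u i a) (u i b))]
  refine Finset.sum_congr rfl fun b _ => ?_
  rw [Finset.sum_eq_single i (fun i' _ hi' => Finset.sum_eq_zero fun a _ => hoff i' i hi' a b)
    (fun h => absurd (Finset.mem_univ i) h)]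
  exact Finset.sum_congr rfl fun a _ => hQB i a b

end Gram

open MvPolynomial

section Degree

variable {n : ℕ}

theorem mem_polyLE_iff {k : ℤ} {p : MvPolynomial (Fin n) ℝ} :
    p ∈ polyLE n k ↔ p = 0 ∨ (p.totalDegree : ℤ) ≤ k := by
  constructor
  · intro hp
    by_cases h0 : p = 0
    · exact Or.inl h0
    · refine Or.inr ?_
      rw [← degree_degLexDegree]
      exact hp (MonomialOrder.degree_mem_support h0)
  · rintro (rfl | h)
    · exact Submodule.zero_mem _
    · intro m hm
      have h1 : m.degree ≤ p.totalDegree := le_totalDegree hm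
      exact le_trans (by exact_mod_cast h1) h

theorem mul_mem_polyLE {k l : ℤ} {p q : MvPolynomial (Fin n) ℝ} (hp : p ∈ polyLE n k)
    (hq : q ∈ polyLE n l) : p * q ∈ polyLE n (k + l) := by
  rw [mem_polyLE_iff] at *
  rcases hp with rfl | hp
  · simp
  rcases hq with rfl | hq
  · simp
  refine Or.inr ?_
  have := totalDegree_mul p q
  omega

instance finiteDimensional_polyLE (k : ℤ) : FiniteDimensional ℝ (polyLE n k) := by
  have hle : polyLE n k ≤ restrictTotalDegree (Fin n) ℝ k.toNat := by
    intro p hp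
    rw [mem_restrictTotalDegree]
    rcases mem_polyLE_iff.mp hp with rfl | h
    · simp
    · omega
  exact Submodule.finiteDimensional_of_le hle

/-- Adding a square to a polynomial with nonnegative leading coefficient does not cancel the
leading term of the square. -/
theorem leadingCoeff_sq_add {a s : MvPolynomial (Fin n) ℝ}
    (hs : 0 ≤ MonomialOrder.degLex.leadingCoeff s) :
    0 ≤ MonomialOrder.degLex.leadingCoeff (a * a + s) ∧
      (a ≠ 0 → a * a + s ≠ 0 ∧ (a * a).totalDegree ≤ (a * a + s).totalDegree) := by
  by_cases ha : a = 0
  · simpa [ha] using hs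
  have haa : a * a ≠ 0 := mul_ne_zero ha ha
  have hlc : 0 < MonomialOrder.degLex.leadingCoeff (a * a) := by
    rw [MonomialOrder.leadingCoeff_mul]
    exact mul_self_pos.mpr (MonomialOrder.leadingCoeff_ne_zero_iff.mpr ha)
  rcases lt_trichotomy (MonomialOrder.degLex.toSyn (MonomialOrder.degLex.degree s))
    (MonomialOrder.degLex.toSyn (MonomialOrder.degLex.degree (a * a))) with h | h | h
  · have h1 := MonomialOrder.leadingCoeff_add_of_lt h
    have h2 := MonomialOrder.degree_add_of_lt h
    refine ⟨h1 ▸ hlc.le, fun _ => ⟨?_, ?_⟩⟩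
    · rw [← MonomialOrder.degLex.leadingCoeff_ne_zero_iff, h1]
      exact hlc.ne'
    · rw [← degree_degLexDegree, ← degree_degLexDegree, h2]
  · have h' := MonomialOrder.degLex.toSyn.injective h
    have hco : 0 < (a * a + s).coeff (MonomialOrder.degLex.degree (a * a)) := by
      rw [coeff_add]
      have : 0 ≤ s.coeff (MonomialOrder.degLex.degree (a * a)) := by rw [← h']; exact hs
      exact add_pos_of_pos_of_nonneg hlc this
    have hle := MonomialOrder.degLex.le_degree (mem_support_iff.mpr hco.ne')
    have hge := MonomialOrder.degLex.degree_add_le (f := a * a) (g := s)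
    rw [h, max_self] at hge
    have heq := MonomialOrder.degLex.toSyn.injective (le_antisymm hge hle)
    refine ⟨?_, fun _ => ⟨?_, ?_⟩⟩
    · rw [MonomialOrder.leadingCoeff, heq]
      exact hco.le
    · intro h0
      rw [h0] at hco
      simp at hco
    · rw [← degree_degLexDegree, ← degree_degLexDegree, heq]
  · have h1 := MonomialOrder.leadingCoeff_add_of_lt h
    have h2 := MonomialOrder.degree_add_of_lt h
    rw [add_comm s] at h1 h2
    refine ⟨h1 ▸ hs, fun _ => ⟨?_, ?_⟩⟩
    · rw [← MonomialOrder.degLex.leadingCoeff_ne_zero_iff, h1,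
        MonomialOrder.degLex.leadingCoeff_ne_zero_iff]
      rintro rfl
      rw [MonomialOrder.degree_zero, map_zero] at h
      exact not_lt.mpr (MonomialOrder.degLex.zero_le _) h
    · refine degLex_totalDegree_monotone ?_
      rw [h2]
      exact h.le

theorem leadingCoeff_nonneg_of_isSumSq {s : MvPolynomial (Fin n) ℝ} (hs : IsSumSq s) :
    0 ≤ MonomialOrder.degLex.leadingCoeff s := by
  induction hs with
  | zero => simp
  | sq_add a _ ih => exact (leadingCoeff_sq_add ih).1

theorem mem_polyLE_of_sq_add_mem {k : ℤ} {a s : MvPolynomial (Fin n) ℝ} (hs : IsSumSq s)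
    (h : a * a + s ∈ polyLE n (2 * k)) : a ∈ polyLE n k ∧ s ∈ polyLE n (2 * k) := by
  have ha : a ∈ polyLE n k := by
    by_cases ha : a = 0
    · exact mem_polyLE_iff.mpr (Or.inl ha)
    obtain ⟨h1, h2⟩ := (leadingCoeff_sq_add (leadingCoeff_nonneg_of_isSumSq hs)).2 ha
    have h3 := (mem_polyLE_iff.mp h).resolve_left h1
    rw [totalDegree_mul_of_isDomain ha ha] at h2
    exact mem_polyLE_iff.mpr (Or.inr (by omega))
  refine ⟨ha, ?_⟩
  have h4 := Submodule.sub_mem _ h (by simpa [two_mul] using mul_mem_polyLE ha ha)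
  rwa [add_sub_cancel_left] at h4

end Degree

section OrbitSum

variable {G : Type*} [Group G] [Fintype G] {n : ℕ} [MulAction G (Fin n)]

/-- The orbit sum as a linear map. -/
noncomputable def orbitSumLinear (G : Type*) [Group G] [Fintype G] {n : ℕ} [MulAction G (Fin n)] :
    MvPolynomial (Fin n) ℝ →ₗ[ℝ] MvPolynomial (Fin n) ℝ :=
  ∑ g : G, (rename (R := ℝ) fun i : Fin n => g • i).toLinearMap

theorem orbitSumLinear_apply (f : MvPolynomial (Fin n) ℝ) :
    orbitSumLinear G f = orbitSum G f := by
  simp [orbitSumLinear, orbitSum, LinearMap.sum_apply]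

theorem orbitSum_rename (g : G) (f : MvPolynomial (Fin n) ℝ) :
    orbitSum G (rename (fun i => g • i) f) = orbitSum G f := by
  refine Fintype.sum_equiv (Equiv.mulRight g) _ _ fun h => ?_
  rw [rename_rename]
  congr 2
  funext i
  simp [mul_smul]

theorem isSumSq_rename {τ υ : Type*} (e : τ → υ) {s : MvPolynomial τ ℝ} (hs : IsSumSq s) :
    IsSumSq (rename e s) := by
  induction hs with
  | zero => simp
  | sq_add a _ ih => rw [map_add, map_mul]; exact IsSumSq.sq_add _ ih

theorem isSumSq_orbitSum {s : MvPolynomial (Fin n) ℝ} (hs : IsSumSq s) :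
    IsSumSq (orbitSum G s) :=
  IsSumSq.sum fun _ _ => isSumSq_rename _ hs

theorem orbitSum_mem_polyLE {k : ℤ} {s : MvPolynomial (Fin n) ℝ} (hs : s ∈ polyLE n k) :
    orbitSum G s ∈ polyLE n k :=
  Submodule.sum_mem _ fun _ _ => rename_mem_polyLE _ hs

theorem pairing_smul {m : ℕ} (c : ℝ) (Q : Matrix (Fin m) (Fin m) ℝ)
    (X : Matrix (Fin m) (Fin m) (MvPolynomial (Fin n) ℝ)) :
    pairing (c • Q) X = c • pairing Q X := by
  simp [pairing, Finset.smul_sum, smul_smul]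

theorem pairing_orbitMatrix {k : ℤ} {m : ℕ} (Q : Matrix (Fin m) (Fin m) ℝ)
    (u : Fin m → polyLE n k) :
    pairing Q (orbitMatrix G u) = orbitSum G (∑ a, ∑ b, Q a b •
      ((u a : MvPolynomial (Fin n) ℝ) * (u b : MvPolynomial (Fin n) ℝ))) := by
  simp [pairing, orbitMatrix, ← orbitSumLinear_apply]

theorem pairing_mem_polyLE {k : ℤ} {m : ℕ} (Q : Matrix (Fin m) (Fin m) ℝ)
    (u : Fin m → polyLE n k) : pairing Q (orbitMatrix G u) ∈ polyLE n (2 * k) := by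
  rw [pairing_orbitMatrix, two_mul]
  exact orbitSum_mem_polyLE (Submodule.sum_mem _ fun a _ => Submodule.sum_mem _ fun b _ =>
    Submodule.smul_mem _ _ (mul_mem_polyLE (u a).2 (u b).2))

open scoped MatrixOrder in
theorem isSumSq_pairing {k : ℤ} {m : ℕ} {Q : Matrix (Fin m) (Fin m) ℝ} (hQ : Q.PosSemidef)
    (u : Fin m → polyLE n k) : IsSumSq (pairing Q (orbitMatrix G u)) := by
  rw [pairing_orbitMatrix]
  refine isSumSq_orbitSum ?_
  obtain ⟨A, hA, -, rfl⟩ :=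
    CFC.exists_sqrt_of_isSelfAdjoint_of_quasispectrumRestricts hQ.isHermitian
      (QuasispectrumRestricts.nnreal_of_nonneg hQ.nonneg)
  have hAs : ∀ a b, A a b = A b a := fun a b => by
    simpa using (hA.isHermitian.apply a b).symm
  have h : ∑ a, ∑ b, (A * A) a b •
      ((u a : MvPolynomial (Fin n) ℝ) * (u b : MvPolynomial (Fin n) ℝ))
      = ∑ c, (∑ a, A c a • (u a : MvPolynomial (Fin n) ℝ)) *
          (∑ a, A c a • (u a : MvPolynomial (Fin n) ℝ)) := by
    simp only [Matrix.mul_apply, Finset.sum_smul, Finset.sum_mul_sum]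
    rw [Finset.sum_comm (s := Finset.univ (α := Fin m)) (f := fun c a => ∑ b, A c a •
      (u a : MvPolynomial (Fin n) ℝ) * A c b • (u b : MvPolynomial (Fin n) ℝ))]
    refine Finset.sum_congr rfl fun a _ => ?_
    rw [Finset.sum_comm]
    refine Finset.sum_congr rfl fun c _ => Finset.sum_congr rfl fun b _ => ?_
    rw [hAs a c, smul_mul_smul_comm]
  rw [h]
  exact IsSumSq.sum_mul_self _ _

/-- The orbit sum of a sum of squares is a combination of the orbit matrices of a representative
set with positive semidefinite coefficients. -/
theorem IsRepresentativeSet.exists_pairing (hG : HasInvertingChain G) {k : ℤ}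
    {ι : Type*} [Fintype ι] {m : ι → ℕ} {u : (i : ι) → Fin (m i) → polyLE n k}
    (hu : IsRepresentativeSet (polyRep G n k) m u) {s : MvPolynomial (Fin n) ℝ}
    (hs : IsSumSq s) (hsk : s ∈ polyLE n (2 * k)) :
    ∃ Q : (i : ι) → Matrix (Fin (m i)) (Fin (m i)) ℝ, (∀ i, (Q i).PosSemidef) ∧
      orbitSum G s = ∑ i, pairing (Q i) (orbitMatrix G (u i)) := by
  induction hs with
  | zero =>
    exact ⟨fun _ => 0, fun _ => Matrix.PosSemidef.zero, by simp [orbitSum, pairing]⟩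
  | sq_add a hs ih =>
    obtain ⟨ha, hsk'⟩ := mem_polyLE_of_sq_add_mem hs hsk
    obtain ⟨Q, hQ, hQs⟩ := ih hsk'
    let B : polyLE n k →ₗ[ℝ] polyLE n k →ₗ[ℝ] MvPolynomial (Fin n) ℝ :=
      ((LinearMap.mul ℝ (MvPolynomial (Fin n) ℝ)).compl₁₂ (polyLE n k).subtype
        (polyLE n k).subtype).compr₂ (orbitSumLinear G)
    have hBap : ∀ x y, B x y = orbitSum G (x * y : MvPolynomial (Fin n) ℝ) := fun x y =>
      orbitSumLinear_apply _
    have hB : ∀ g x y, B (polyRep G n k g x) (polyRep G n k g y) = B x y := fun g x y => by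
      rw [hBap, hBap, ← orbitSum_rename g (x * y : MvPolynomial (Fin n) ℝ), map_mul]
      rfl
    obtain ⟨R, hR, hRa⟩ := hu.exists_posSemidef hG B hB ⟨a, ha⟩
    refine ⟨fun i => R i + Q i, fun i => (hR i).add (hQ i), ?_⟩
    have h1 : orbitSum G (a * a) = ∑ i, pairing (R i) (orbitMatrix G (u i)) := by
      have := hRa
      simp only [hBap] at this
      exact this
    rw [← orbitSumLinear_apply, map_add, orbitSumLinear_apply, orbitSumLinear_apply, h1, hQs,
      ← Finset.sum_add_distrib]
    simp [pairing, add_smul, Finset.sum_add_distrib]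

end OrbitSum

section Cosets

variable {n : ℕ}

theorem rename_perm_cubeGen (g : Equiv.Perm (Fin n)) (i : Fin n) :
    rename g (cubeGen i) = cubeGen (g i) := by
  simp [cubeGen]

theorem orbitSum_perm_eq_sum_swap (l : Fin n) (f : MvPolynomial (Fin n) ℝ) :
    orbitSum (Equiv.Perm (Fin n)) f = ∑ i, rename (Equiv.swap i l)
      (orbitSum (MulAction.stabilizer (Equiv.Perm (Fin n)) l) f) := by
  simp only [orbitSum, map_sum, rename_rename]
  rw [← Fintype.sum_prod_type']
  let e : Fin n × MulAction.stabilizer (Equiv.Perm (Fin n)) l ≃ Equiv.Perm (Fin n) :=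
    { toFun := fun x => Equiv.swap x.1 l * x.2
      invFun := fun g => (g l, ⟨Equiv.swap (g l) l * g, by
        simp [MulAction.mem_stabilizer_iff]⟩)
      left_inv := fun x => by
        have hx : (x.2 : Equiv.Perm (Fin n)) l = l := x.2.2
        refine Prod.ext ?_ (Subtype.ext ?_) <;> simp [hx, ← mul_assoc]
      right_inv := fun g => by simp [← mul_assoc] }
  exact (Fintype.sum_equiv e _ _ fun x => rfl).symm

theorem orbitSum_mul_cubeGen (l : Fin n) (σ : Fin n → MvPolynomial (Fin n) ℝ) :
    orbitSum (Equiv.Perm (Fin n)) (∑ i, σ i * cubeGen i) =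
      ∑ i, rename (Equiv.swap i l) (orbitSum (MulAction.stabilizer (Equiv.Perm (Fin n)) l)
        (∑ j, rename (Equiv.swap j l) (σ j))) * cubeGen i := by
  have h1 : orbitSum (Equiv.Perm (Fin n)) (∑ i, σ i * cubeGen i) =
      orbitSum (Equiv.Perm (Fin n)) ((∑ j, rename (Equiv.swap j l) (σ j)) * cubeGen l) := by
    rw [Finset.sum_mul]
    simp only [← orbitSumLinear_apply, map_sum]
    refine Finset.sum_congr rfl fun i _ => ?_
    rw [orbitSumLinear_apply, orbitSumLinear_apply, ← orbitSum_rename (Equiv.swap i l)]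
    change orbitSum _ (rename (Equiv.swap i l) _) = _
    rw [map_mul, rename_perm_cubeGen, Equiv.swap_apply_left]
  rw [h1, orbitSum_perm_eq_sum_swap l]
  refine Finset.sum_congr rfl fun i _ => ?_
  have h2 : ∀ f : MvPolynomial (Fin n) ℝ,
      orbitSum (MulAction.stabilizer (Equiv.Perm (Fin n)) l) (f * cubeGen l) =
        orbitSum (MulAction.stabilizer (Equiv.Perm (Fin n)) l) f * cubeGen l := by
    intro f
    simp only [orbitSum, Finset.sum_mul]
    refine Finset.sum_congr rfl fun g _ => ?_
    rw [map_mul]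
    congr 1
    exact (rename_perm_cubeGen (g : Equiv.Perm (Fin n)) l).trans (congrArg cubeGen g.2)
  rw [h2, map_mul, rename_perm_cubeGen, Equiv.swap_apply_right]

end Cosets

end HypercubeSDP

open HypercubeSDP in
/-- The index types `Λ` and `M` of the irreducible types are arbitrary finite types, for example
the partitions of `n` and of `n - 1`. -/
theorem mainTheorem3 (n d : ℕ) (hn : 0 < n)
    (p : MvPolynomial (Fin n) ℝ) (hp : p.IsSymmetric)
    {Λ M : Type*} [Fintype Λ] [Fintype M]
    (m : Λ → ℕ) (u : (l : Λ) → Fin (m l) → polyLE n d)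
    (hu : IsRepresentativeSet (polyRep (Equiv.Perm (Fin n)) n d) m u)
    (r : M → ℕ) (v : (μ : M) → Fin (r μ) → polyLE n ((d : ℤ) - 1))
    (hv : IsRepresentativeSet (polyRep (StabLast n hn) n ((d : ℤ) - 1)) r v) :
    p ∈ truncQuadModule n (2 * d) ↔
      ∃ (Q : (l : Λ) → Matrix (Fin (m l)) (Fin (m l)) ℝ)
        (R : (μ : M) → Matrix (Fin (r μ)) (Fin (r μ)) ℝ),
        (∀ l, (Q l).PosSemidef) ∧ (∀ μ, (R μ).PosSemidef) ∧
        p = ∑ l, pairing (Q l) (orbitMatrix (Equiv.Perm (Fin n)) (u l)) +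
          ∑ i, MvPolynomial.rename (Equiv.swap i (lastVar n hn))
            (∑ μ, pairing (R μ) (orbitMatrix (StabLast n hn) (v μ))) * cubeGen i := by
  have hdeg : 2 * (d : ℤ) - 2 = 2 * ((d : ℤ) - 1) := by ring
  constructor
  · rintro ⟨σ₀, σ, hσ₀, hσ₀d, hσ, hpσ⟩
    obtain ⟨Q, hQ, hQs⟩ := hu.exists_pairing (hasInvertingChain_perm n) hσ₀ hσ₀d
    obtain ⟨R, hR, hRs⟩ := hv.exists_pairing (hasInvertingChain_stabilizer (lastVar n hn))
      (s := ∑ j, MvPolynomial.rename (Equiv.swap j (lastVar n hn)) (σ j))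
      (IsSumSq.sum fun j _ => isSumSq_rename _ (hσ j).1)
      (Submodule.sum_mem _ fun j _ => rename_mem_polyLE _ (hdeg ▸ (hσ j).2))
    have hcard : (Fintype.card (Equiv.Perm (Fin n)) : ℝ) ≠ 0 :=
      Nat.cast_ne_zero.mpr Fintype.card_ne_zero
    have hsum : (Fintype.card (Equiv.Perm (Fin n)) : ℝ) • p =
        ∑ l, pairing (Q l) (orbitMatrix (Equiv.Perm (Fin n)) (u l)) +
          ∑ i, MvPolynomial.rename (Equiv.swap i (lastVar n hn))
            (∑ μ, pairing (R μ) (orbitMatrix (StabLast n hn) (v μ))) * cubeGen i := by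
      rw [← hQs, ← hRs, ← orbitSum_mul_cubeGen, ← orbitSumLinear_apply, ← orbitSumLinear_apply,
        ← map_add, ← hpσ, orbitSumLinear_apply]
      refine Eq.trans ?_ (Finset.sum_congr rfl fun g _ => (hp g).symm)
      rw [Finset.sum_const, Finset.card_univ, Nat.cast_smul_eq_nsmul]
    refine ⟨fun l => (Fintype.card (Equiv.Perm (Fin n)) : ℝ)⁻¹ • Q l,
      fun μ => (Fintype.card (Equiv.Perm (Fin n)) : ℝ)⁻¹ • R μ,
      fun l => (hQ l).smul (by positivity), fun μ => (hR μ).smul (by positivity), ?_⟩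
    simp only [pairing_smul, ← Finset.smul_sum, map_smul, smul_mul_assoc]
    rw [← smul_add, ← hsum, inv_smul_smul₀ hcard]
  · rintro ⟨Q, R, hQ, hR, rfl⟩
    refine ⟨_, fun i => MvPolynomial.rename (Equiv.swap i (lastVar n hn))
      (∑ μ, pairing (R μ) (orbitMatrix (StabLast n hn) (v μ))),
      IsSumSq.sum fun l _ => isSumSq_pairing (hQ l) (u l),
      Submodule.sum_mem _ fun l _ => pairing_mem_polyLE (Q l) (u l), fun i => ⟨?_, ?_⟩, rfl⟩
    · exact isSumSq_rename _ (IsSumSq.sum fun μ _ => isSumSq_pairing (hR μ) (v μ))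
    · rw [hdeg]
      exact rename_mem_polyLE _ (Submodule.sum_mem _ fun μ _ => pairing_mem_polyLE (R μ) (v μ))
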